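/- Let $n\ge 1$ and $m$ be integers and consider $n$ agents, labeled by $\mathcal V=\{1,\dots,n\}$, with positions $q_i(t)\in\mathbb R^m$ and Lagrangian dynamics $$M_i(q_i)\ddot q_i+C_i(q_i,\dot q_i)\dot q_i=\tau_i,\qquad i\in\mathcal V,$$ where, for each $i$, the matrix $M_i(q)\in\mathbb R^{m\times m}$ is symmetric, positive definite, bounded and differentiable in $q$; $\dot M_i(q_i)-2C_i(q_i,\dot q_i)$ is skew symmetric; and $\|C_i(q,v)\|\le k_C\|v\|$ for all $q,v\in\mathbb R^m$ and some constant $k_C>0$. Let $\mathcal X_1,\dots,\mathcal X_n\subseteq\mathbb R^m$ be closed convex sets whose intersection $\mathcal X_0=\bigcap_{i=1}^n\mathcal X_i$ is nonempty and bounded, and let $P_{\mathcal X_i}$ be the Euclidean projection onto $\mathcal X_i$. Let $\mathcal G_{\sigma(t)}$, $t\ge t_0$, be a switching undirected graph on $\mathcal V$ that is constant on each interval $[t_l,t_{l+1})$, $l=0,1,\dots$, where $t_0<t_1<\cdots$ and $t_{l+1}-t_l\ge\tau_d$ for all $l\ge1$ and some dwell time $\tau_d>0$. Let $\mathcal N_i(\sigma(t))$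 be the set of neighbors of $i$ in $\mathcal G_{\sigma(t)}$. Let the weights $a_{ij}(t)=a_{ji}(t)$ be continuous on $[t_0,\infty)$ with $a_*\le a_{ij}(t)\le a^*$ for all $i,j\in\mathcal V$ and $t\ge t_0$, where $a_*,a^*>0$ are constants. Consider the control $$\tau_i=C_i(q_i,\dot q_i)\dot q_i-kM_i(q_i)\dot q_i-M_i(q_i)\bigl(q_i-P_{\mathcal X_i}(q_i)\bigr)-M_i(q_i)\sum_{j\in\mathcal N_i(\sigma(t))}a_{ij}(t)(q_i-q_j),\qquad i\in\mathcal V.$$ Suppose that $\mathcal G_{\sigma(t)}$ is uniformly jointly connected: there is $T>0$ such that for every $t\ge t_0$ the union of the graphs $\mathcal G_{\sigma(s)}$, $s\in[t,t+T)$, is connected. Then, for all $k$ large enough (larger than a constant depending only on $n$ and $a^*$), every solution of the closed-loop system on $[t_0,\infty)$ achieves set aggregation: for all $i,j\in\mathcal V$, as $t\to\infty$, $$\operatorname{dist}(q_i(t),\mathcal X_0)\to0,\qquad q_i(t)-q_j(t)\to0,\qquad \dot q_i(t)\to0.$$ -/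

import Mathlib

open Filter Topology Set
open scoped BigOperators

noncomputable section

/-- A point of `S` at minimal distance from `x`. For a nonempty closed convex set it exists and is
unique (see `convexProj_spec` and `convexProj_unique`). -/
def convexProj {m : ℕ} (S : Set (EuclideanSpace ℝ (Fin m))) (x : EuclideanSpace ℝ (Fin m)) :
    EuclideanSpace ℝ (Fin m) :=
  Classical.epsilon fun p => p ∈ S ∧ ‖x - p‖ = Metric.infDist x S

theorem convexProj_spec {m : ℕ} {S : Set (EuclideanSpace ℝ (Fin m))} (hc : IsClosed S)
    (hne : S.Nonempty) (x : EuclideanSpace ℝ (Fin m)) :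
    convexProj S x ∈ S ∧ ‖x - convexProj S x‖ = Metric.infDist x S := by
  obtain ⟨p, hp, hd⟩ := hc.exists_infDist_eq_dist hne x
  exact Classical.epsilon_spec (p := fun p => p ∈ S ∧ ‖x - p‖ = Metric.infDist x S)
    ⟨p, hp, by rw [hd, dist_eq_norm]⟩

theorem convexProj_unique {m : ℕ} {S : Set (EuclideanSpace ℝ (Fin m))} (hc : IsClosed S)
    (hconv : Convex ℝ S) (x p : EuclideanSpace ℝ (Fin m)) (hp : p ∈ S)
    (hd : ‖x - p‖ = Metric.infDist x S) : p = convexProj S x := by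
  obtain ⟨hr, he⟩ := convexProj_spec hc ⟨p, hp⟩ x
  set r := convexProj S x with hrdef
  have hmid : (1 / 2 : ℝ) • p + (1 / 2 : ℝ) • r ∈ S :=
    hconv hp hr (by norm_num) (by norm_num) (by norm_num)
  have hle := Metric.infDist_le_dist_of_mem (x := x) hmid
  rw [dist_eq_norm] at hle
  have h0 : 0 ≤ Metric.infDist x S := Metric.infDist_nonneg
  have hpar := parallelogram_law_with_norm ℝ (x - p) (x - r)
  have hsum : (x - p) + (x - r) = (2 : ℝ) • (x - ((1 / 2 : ℝ) • p + (1 / 2 : ℝ) • r)) := by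
    module
  have hdiff : (x - p) - (x - r) = r - p := by abel
  rw [hsum, hdiff, norm_smul, hd, he] at hpar
  norm_num at hpar
  have hz : ‖r - p‖ = 0 := by
    have hn := norm_nonneg (r - p)
    norm_num at hle
    nlinarith
  exact (sub_eq_zero.mp (norm_eq_zero.mp hz)).symm

/-- A real `m × m` matrix acting on a vector of Euclidean `m`-space. -/
abbrev matApply {m : ℕ} (A : Matrix (Fin m) (Fin m) ℝ) (x : EuclideanSpace ℝ (Fin m)) :
    EuclideanSpace ℝ (Fin m) :=
  Matrix.toEuclideanCLM (n := Fin m) (𝕜 := ℝ) A x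

/-- The time derivative of `t ↦ M (q t)` along a curve passing through `q` with velocity `v`. -/
def matrixDot {m : ℕ} (M : EuclideanSpace ℝ (Fin m) → Matrix (Fin m) (Fin m) ℝ)
    (q v : EuclideanSpace ℝ (Fin m)) : Matrix (Fin m) (Fin m) ℝ :=
  Matrix.of fun r s => fderiv ℝ (fun x => M x r s) q v

/-- The inertia matrix `M q` and the Coriolis matrix `C q v` of a Lagrangian system
`M(q) q'' + C(q, q') q' = τ`, with the standard properties of such systems. -/
structure IsLagrangian {m : ℕ} (M : EuclideanSpace ℝ (Fin m) → Matrix (Fin m) (Fin m) ℝ)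
    (C : EuclideanSpace ℝ (Fin m) → EuclideanSpace ℝ (Fin m) → Matrix (Fin m) (Fin m) ℝ) :
    Prop where
  /-- `M` is differentiable (so that `Ṁ` makes sense). -/
  differentiable : ∀ r s, Differentiable ℝ fun q => M q r s
  /-- `M q` is symmetric and positive definite. -/
  posDef : ∀ q, (M q).PosDef
  /-- `M` is bounded. -/
  bounded : ∃ K : ℝ, ∀ q r s, |M q r s| ≤ K
  /-- `Ṁ - 2 C` is skew symmetric. -/
  skew : ∀ q v, (matrixDot M q v - 2 • C q v).transpose = -(matrixDot M q v - 2 • C q v)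
  /-- `‖C q v‖ ≤ k_C ‖v‖` in the operator norm induced by the Euclidean norm. -/
  coriolis_bound : ∃ kC : ℝ, 0 < kC ∧
    ∀ q v, ‖Matrix.toEuclideanCLM (n := Fin m) (𝕜 := ℝ) (C q v)‖ ≤ kC * ‖v‖

/-- On `[t₀, ∞)` the graph is constant on the intervals `[t_l, t_{l+1})`, whose lengths are, from
`l = 1` on, at least a dwell time `τd > 0` (`t_l` need not be an actual change of the graph). -/
def HasDwellTime {n : ℕ} (G : ℝ → SimpleGraph (Fin n)) (t₀ : ℝ) : Prop :=
  ∃ τd : ℝ, 0 < τd ∧ ∃ ts : ℕ → ℝ, ts 0 = t₀ ∧ ts 0 < ts 1 ∧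
    (∀ l, 1 ≤ l → τd ≤ ts (l + 1) - ts l) ∧
    ∀ l, ∀ t ∈ Ico (ts l) (ts (l + 1)), G t = G (ts l)

/-- For some `T > 0`, the union of the graphs over `[t, t + T)` is connected for all `t ≥ t₀`. -/
def UniformlyJointlyConnected {n : ℕ} (G : ℝ → SimpleGraph (Fin n)) (t₀ : ℝ) : Prop :=
  ∃ T : ℝ, 0 < T ∧ ∀ t, t₀ ≤ t → (⨆ s ∈ Ico t (t + T), G s).Connected

open Classical in
/-- The sum `∑ a_ij (q_i - q_j)` over the neighbours `j` of `i` in the graph `G`. -/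
def neighborCoupling {n m : ℕ} (G : SimpleGraph (Fin n)) (a : Fin n → Fin n → ℝ)
    (q : Fin n → EuclideanSpace ℝ (Fin m)) (i : Fin n) : EuclideanSpace ℝ (Fin m) :=
  ∑ j ∈ Finset.univ.filter (fun j => G.Adj i j), a i j • (q i - q j)

/-- The control force `τ_i` applied to agent `i`, given the current graph `G`, the current weights
`a` and the current positions `q` and velocities `v` of all agents. -/
def controlForce {n m : ℕ} (k : ℝ)
    (M : Fin n → EuclideanSpace ℝ (Fin m) → Matrix (Fin m) (Fin m) ℝ)
    (C : Fin n → EuclideanSpace ℝ (Fin m) → EuclideanSpace ℝ (Fin m) →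
      Matrix (Fin m) (Fin m) ℝ)
    (X : Fin n → Set (EuclideanSpace ℝ (Fin m)))
    (G : SimpleGraph (Fin n)) (a : Fin n → Fin n → ℝ)
    (q v : Fin n → EuclideanSpace ℝ (Fin m)) (i : Fin n) : EuclideanSpace ℝ (Fin m) :=
  matApply (C i (q i) (v i)) (v i)
    - k • matApply (M i (q i)) (v i)
    - matApply (M i (q i)) (q i - convexProj (X i) (q i))
    - matApply (M i (q i)) (neighborCoupling G a q i)

/-- `q`, with velocity `v = q'`, solves on `[t₀, ∞)` the Lagrangian equations
`M_i(q_i) q_i'' + C_i(q_i, q_i') q_i' = τ_i` with the control force above. The velocities are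
continuous, and since the graph is right-continuous and may jump at switching times, `q_i''` is the
right derivative of the velocity (between switching times it is then the ordinary derivative). -/
structure IsClosedLoopSolution {n m : ℕ} (k : ℝ)
    (M : Fin n → EuclideanSpace ℝ (Fin m) → Matrix (Fin m) (Fin m) ℝ)
    (C : Fin n → EuclideanSpace ℝ (Fin m) → EuclideanSpace ℝ (Fin m) →
      Matrix (Fin m) (Fin m) ℝ)
    (X : Fin n → Set (EuclideanSpace ℝ (Fin m)))
    (G : ℝ → SimpleGraph (Fin n)) (a : Fin n → Fin n → ℝ → ℝ) (t₀ : ℝ)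
    (q v : Fin n → ℝ → EuclideanSpace ℝ (Fin m)) : Prop where
  hasDeriv_pos : ∀ i, ∀ t, t₀ ≤ t → HasDerivWithinAt (q i) (v i t) (Ici t₀) t
  continuousOn_vel : ∀ i, ContinuousOn (v i) (Ici t₀)
  dynamics : ∀ i, ∀ t, t₀ ≤ t → ∃ acc : EuclideanSpace ℝ (Fin m),
    HasDerivWithinAt (v i) acc (Ici t) t ∧
    matApply (M i (q i t)) acc + matApply (C i (q i t) (v i t)) (v i t) =
      controlForce k M C X (G t) (fun i j => a i j t) (fun j => q j t) (fun j => v j t) i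

/-- Cooperative set aggregation of the trajectories `q` with velocities `v`. -/
structure AchievesSetAggregation {n m : ℕ} (X : Fin n → Set (EuclideanSpace ℝ (Fin m)))
    (q v : Fin n → ℝ → EuclideanSpace ℝ (Fin m)) : Prop where
  target : ∀ i, Tendsto (fun t => Metric.infDist (q i t) (⋂ j, X j)) atTop (𝓝 0)
  consensus : ∀ i j, Tendsto (fun t => q i t - q j t) atTop (𝓝 0)
  velocity : ∀ i, Tendsto (v i) atTop (𝓝 0)

end

/-! ### Projections onto convex sets. -/

section Projection

variable {m : ℕ}

/-! Since each M_i is invertible, the control cancels the Lagrangian terms and leaves damped double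
integrators q'' = -kq' - g_i - L_i, with g_i = q_i - P(q_i) and L_i the coupling term. Fix z in
every target set. The vector k(q_i - z) + v_i has derivative -g_i - L_i, free of velocity, so the
sum V of its squared norm and ‖v_i‖² is a natural Lyapunov function. Convexity gives ⟨q_i - z, g_i⟩
≥ ‖g_i‖², symmetry of the weights turns the sum of ⟨q_i - z, L_i⟩ into a disagreement energy, and a
large k absorbs the cross terms with v_i (`lyapunov_rate_le`). Hence V' ≤ -W, where W sums the
‖g_i‖², the ‖v_i‖² and the weighted edge energies.

V bounds positions and velocities, hence accelerations, so a Barbalat argument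
(`tendsto_zero_of_dissipation`) sends v_i and dist(q_i, X_i) to 0. The edge energy jumps with the
graph and needs another argument: each edge persists for a fixed time δ, during which slow agents
barely move, so a persistent gap would cost V a fixed amount each time. Joint connectivity then
spreads agreement from edges to all pairs, and compactness passes from the sets to their
intersection. -/

theorem norm_sub_convexProj_sq_le_inner {S : Set (EuclideanSpace ℝ (Fin m))} (hc : IsClosed S)
    (hconv : Convex ℝ S) {z : EuclideanSpace ℝ (Fin m)} (hz : z ∈ S)
    (x : EuclideanSpace ℝ (Fin m)) :
    ‖x - convexProj S x‖ ^ 2 ≤ inner ℝ (x - z) (x - convexProj S x) := by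
  obtain ⟨hp, hd⟩ := convexProj_spec hc ⟨z, hz⟩ x
  -- Obtuse angle criterion: ⟨x - p, z - p⟩ ≤ 0 at the projection p.
  have h := (norm_eq_iInf_iff_real_inner_le_zero hconv (u := x) hp).1 (by
    rw [hd, Metric.infDist_eq_iInf]
    simp only [dist_eq_norm]) z hz
  have e : x - z = (x - convexProj S x) - (z - convexProj S x) := by abel
  rw [e, inner_sub_left, real_inner_self_eq_norm_sq, real_inner_comm]
  linarith

end Projection

/-! ### Energy estimates for symmetric coupling. -/

section Coupling

variable {n : ℕ} {E : Type*} [NormedAddCommGroup E] [InnerProductSpace ℝ E]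

/-- Discrete integration by parts: adding the copy with i and j exchanged makes z drop out. -/
theorem sum_inner_symm_coupling (b : Fin n → Fin n → ℝ) (hb : ∀ i j, b i j = b j i)
    (x : Fin n → E) (z : E) :
    2 * ∑ i, inner ℝ (x i - z) (∑ j, b i j • (x i - x j)) =
      ∑ i, ∑ j, b i j * ‖x i - x j‖ ^ 2 := by
  have h1 : ∑ i, inner ℝ (x i - z) (∑ j, b i j • (x i - x j)) =
      ∑ i, ∑ j, b i j * inner ℝ (x i - z) (x i - x j) := by
    simp only [inner_sum, inner_smul_right]
  have h2 : ∑ i, ∑ j, b i j * inner ℝ (x i - z) (x i - x j) =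
      ∑ i, ∑ j, b i j * inner ℝ (x j - z) (x j - x i) := by
    rw [Finset.sum_comm]
    exact Finset.sum_congr rfl fun i _ => Finset.sum_congr rfl fun j _ => by rw [hb]
  rw [two_mul, h1]
  nth_rewrite 2 [h2]
  simp only [← Finset.sum_add_distrib]
  refine Finset.sum_congr rfl fun i _ => Finset.sum_congr rfl fun j _ => ?_
  have e : x i - x j = (x i - z) - (x j - z) := by abel
  have e' : x j - x i = -(x i - x j) := by abel
  rw [← mul_add, e', inner_neg_right, ← sub_eq_add_neg, ← inner_sub_left, ← e,
    real_inner_self_eq_norm_sq]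

/-- Young's inequality edge by edge: expand 0 ≤ ‖w + (x i - x j)‖² with weight b i j. -/
theorem neg_two_mul_inner_coupling_le (b : Fin n → Fin n → ℝ) {A : ℝ} (h0 : ∀ i j, 0 ≤ b i j)
    (hA : ∀ i j, b i j ≤ A) (x : Fin n → E) (w : E) (i : Fin n) :
    -(2 * inner ℝ w (∑ j, b i j • (x i - x j))) ≤
      n * A * ‖w‖ ^ 2 + ∑ j, b i j * ‖x i - x j‖ ^ 2 := by
  have h1 : n * A * ‖w‖ ^ 2 = ∑ _j : Fin n, A * ‖w‖ ^ 2 := by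
    simp [mul_assoc]
  rw [h1, ← Finset.sum_add_distrib, inner_sum, Finset.mul_sum, ← Finset.sum_neg_distrib]
  refine Finset.sum_le_sum fun j _ => ?_
  rw [inner_smul_right]
  have h2 : 0 ≤ ‖w + (x i - x j)‖ ^ 2 := sq_nonneg _
  rw [norm_add_sq_real] at h2
  have h3 := mul_nonneg (h0 i j) h2
  have h4 := mul_le_mul_of_nonneg_right (hA i j) (sq_nonneg ‖w‖)
  linarith

/-- The rate at which the damped coupled system dissipates its Lyapunov function. -/
theorem lyapunov_rate_le (b : Fin n → Fin n → ℝ) {A k : ℝ} (hb : ∀ i j, b i j = b j i)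
    (h0 : ∀ i j, 0 ≤ b i j) (hA : ∀ i j, b i j ≤ A) (hA0 : 0 ≤ A) (hk : 4 + n * A ≤ k)
    (x v g : Fin n → E) (z : E) (hg : ∀ i, ‖g i‖ ^ 2 ≤ inner ℝ (x i - z) (g i)) :
    ∑ i, (2 * inner ℝ (k • (x i - z) + v i)
          (k • v i + (-(k • v i) - g i - ∑ j, b i j • (x i - x j)))
        + 2 * inner ℝ (v i) (-(k • v i) - g i - ∑ j, b i j • (x i - x j))) ≤
      -(∑ i, ‖g i‖ ^ 2 + ∑ i, ∑ j, b i j * ‖x i - x j‖ ^ 2 + ∑ i, ‖v i‖ ^ 2) := by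
  have hnA : 0 ≤ n * A := by positivity
  have hD : 0 ≤ ∑ i, ∑ j, b i j * ‖x i - x j‖ ^ 2 :=
    Finset.sum_nonneg fun i _ => Finset.sum_nonneg fun j _ => mul_nonneg (h0 i j) (sq_nonneg _)
  have hterm : ∀ i, 2 * inner ℝ (k • (x i - z) + v i)
          (k • v i + (-(k • v i) - g i - ∑ j, b i j • (x i - x j)))
        + 2 * inner ℝ (v i) (-(k • v i) - g i - ∑ j, b i j • (x i - x j)) ≤
      -(2 * k) * inner ℝ (x i - z) (∑ j, b i j • (x i - x j))
        + (2 * ∑ j, b i j * ‖x i - x j‖ ^ 2) - ‖g i‖ ^ 2 - ‖v i‖ ^ 2 := by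
    intro i
    have h1 := neg_two_mul_inner_coupling_le b h0 hA x (v i) i
    set L := ∑ j, b i j • (x i - x j)
    have h2 : 0 ≤ ‖v i + g i‖ ^ 2 := sq_nonneg _
    rw [norm_add_sq_real] at h2
    have e : k • v i + (-(k • v i) - g i - L) = -g i - L := by abel
    rw [e]
    simp only [inner_add_left, inner_sub_right, inner_neg_right, inner_smul_left, inner_smul_right,
      real_inner_self_eq_norm_sq, RCLike.conj_to_real]
    have h3 := mul_le_mul_of_nonneg_left (hg i) (show 0 ≤ k by linarith)
    have h4 := mul_nonneg (show 0 ≤ k - 4 - n * A by linarith) (sq_nonneg ‖v i‖)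
    have h5 := mul_nonneg (show 0 ≤ k - 4 by linarith) (sq_nonneg ‖g i‖)
    nlinarith [sq_nonneg ‖v i‖, sq_nonneg ‖g i‖, mul_nonneg hnA (sq_nonneg ‖v i‖)]
  refine (Finset.sum_le_sum fun i _ => hterm i).trans ?_
  simp only [Finset.sum_add_distrib, Finset.sum_sub_distrib, ← Finset.mul_sum]
  have h6 := sum_inner_symm_coupling b hb x z
  set D := ∑ i, ∑ j, b i j * ‖x i - x j‖ ^ 2
  have h7 : -(2 * k) * ∑ i, inner ℝ (x i - z) (∑ j, b i j • (x i - x j)) = -k * D := by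
    rw [← h6]; ring
  rw [h7]
  nlinarith [mul_nonneg (show 0 ≤ k - 4 by linarith) hD]

end Coupling

/-! ### Decay from a dissipation inequality. -/

section Dissipation

/-- Comparison of V with a line of slope -c. Right derivatives suffice, so switching times need no
separate treatment. -/
theorem dissipation_le_sub {V W : ℝ → ℝ} {t₀ : ℝ} (hV : ContinuousOn V (Ici t₀))
    (hd : ∀ t, t₀ ≤ t → ∃ d, HasDerivWithinAt V d (Ici t) t ∧ d ≤ -W t)
    {s t c : ℝ} (hs : t₀ ≤ s) (hst : s ≤ t) (hc : ∀ r ∈ Ico s t, c ≤ W r) :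
    c * (t - s) ≤ V s - V t := by
  choose! d hd hdW using hd
  have := image_le_of_deriv_right_le_deriv_boundary (f := V) (f' := d) (a := s) (b := t)
    (B := fun r => V s - c * (r - s)) (B' := fun _ => -c)
    (hV.mono fun r hr => hs.trans hr.1) (fun r hr => hd r (hs.trans hr.1)) (by simp)
    (by fun_prop)
    (fun r _ => by
      have h : HasDerivAt (fun r => V s - c * (r - s)) (-(c * 1)) r :=
        (((hasDerivAt_id r).sub_const s).const_mul c).const_sub (V s)
      rw [mul_one] at h
      exact h.hasDerivWithinAt)
    (fun r hr => (hdW r (hs.trans hr.1)).trans (neg_le_neg (hc r hr)))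
    (right_mem_Icc.2 hst)
  linarith

/-- A nonincreasing nonnegative function has vanishing decrements over windows of fixed length. -/
theorem eventually_decrement_lt {V : ℝ → ℝ} {t₀ : ℝ} (hV : AntitoneOn V (Ici t₀))
    (h0 : ∀ t, t₀ ≤ t → 0 ≤ V t) {ε : ℝ} (hε : 0 < ε) :
    ∃ t₁, t₀ ≤ t₁ ∧ ∀ s t, t₁ ≤ s → s ≤ t → V s - V t < ε := by
  have hbdd : BddBelow (V '' Ici t₀) := ⟨0, by rintro _ ⟨t, ht, rfl⟩; exact h0 t ht⟩
  obtain ⟨_, ⟨t₁, ht₁, rfl⟩, hlt⟩ := exists_lt_of_csInf_lt (s := V '' Ici t₀)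
    ⟨_, mem_image_of_mem V self_mem_Ici⟩ (lt_add_of_pos_right (sInf (V '' Ici t₀)) hε)
  refine ⟨t₁, ht₁, fun s t hs hst => ?_⟩
  have hs0 : t₀ ≤ s := le_trans ht₁ hs
  have h1 := csInf_le hbdd (mem_image_of_mem V (show t ∈ Ici t₀ from hs0.trans hst))
  have h2 := hV ht₁ hs0 hs
  linarith

/-- A Barbalat lemma: a Lipschitz function whose square is dissipated tends to zero. -/
theorem tendsto_zero_of_dissipation {V W h : ℝ → ℝ} {t₀ K : ℝ} (hV : ContinuousOn V (Ici t₀))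
    (hd : ∀ t, t₀ ≤ t → ∃ d, HasDerivWithinAt V d (Ici t) t ∧ d ≤ -W t)
    (hanti : AntitoneOn V (Ici t₀)) (h0 : ∀ t, t₀ ≤ t → 0 ≤ V t)
    (hnn : ∀ t, t₀ ≤ t → 0 ≤ h t) (hK : 0 ≤ K)
    (hlip : ∀ s t, t₀ ≤ s → s ≤ t → h s ≤ h t + K * (t - s))
    (hW : ∀ t, t₀ ≤ t → h t ^ 2 ≤ W t) : Tendsto h atTop (𝓝 0) := by
  rw [Metric.tendsto_atTop]
  intro ε hε
  set δ := ε / (2 * (K + 1)) with hδ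
  have hδ0 : 0 < δ := by positivity
  have hKδ : K * δ ≤ ε / 2 := by
    rw [hδ, mul_div_assoc', div_le_div_iff₀ (by positivity) (by positivity)]
    nlinarith
  obtain ⟨t₁, ht₁, hdec⟩ := eventually_decrement_lt hanti h0
    (show 0 < (ε / 2) ^ 2 * δ by positivity)
  refine ⟨t₁, fun t ht => ?_⟩
  have ht0 : t₀ ≤ t := ht₁.trans ht
  rw [Real.dist_eq, sub_zero, abs_of_nonneg (hnn t ht0)]
  by_contra! hcon
  -- If h t ≥ ε, then h stays above ε / 2 for time δ, as it falls at rate at most K; V then loses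
  -- too much.
  have h1 := dissipation_le_sub hV hd (s := t) (t := t + δ) (c := (ε / 2) ^ 2) ht0 (by linarith)
    fun r hr => by
      have h2 := hlip t r ht0 hr.1
      have h3 : K * (r - t) ≤ K * δ := mul_le_mul_of_nonneg_left (by linarith [hr.2]) hK
      exact (pow_le_pow_left₀ (by positivity) (by linarith) 2).trans (hW r (ht0.trans hr.1))
  have h4 := hdec t (t + δ) ht (by linarith)
  rw [add_sub_cancel_left] at h1
  linarith

end Dissipation

/-! ### Dwell time and connectivity. -/

section Graph

theorem HasDwellTime.exists_constant_window {n : ℕ} {G : ℝ → SimpleGraph (Fin n)} {t₀ : ℝ}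
    (h : HasDwellTime G t₀) :
    ∃ δ t₁ : ℝ, 0 < δ ∧ t₀ ≤ t₁ ∧ ∀ s, t₁ ≤ s →
      ∃ u, s - δ ≤ u ∧ u ≤ s ∧ ∀ r ∈ Ico u (u + δ), G r = G s := by
  obtain ⟨τ, hτ, ts, h0, h01, hdw, hG⟩ := h
  -- An interval of length at least τ around s has room for τ / 2 on one side of s. Starting at `ts
  -- 1` skips the first interval, which may be short.
  refine ⟨τ / 2, ts 1, by positivity, by linarith, fun s hs => ?_⟩
  have hgrow : ∀ l : ℕ, ts 1 + l * τ ≤ ts (l + 1) := by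
    intro l
    induction l with
    | zero => simp
    | succ l ih =>
      have := hdw (l + 1) (by omega)
      push_cast
      linarith
  have hex : ∃ l : ℕ, s < ts (l + 1) := by
    obtain ⟨l, hl⟩ := exists_nat_gt ((s - ts 1) / τ)
    rw [div_lt_iff₀ hτ] at hl
    exact ⟨l, by linarith [hgrow l]⟩
  classical
  obtain ⟨l, hl, hmin⟩ : ∃ l : ℕ, s < ts (l + 1) ∧ ∀ j < l, ¬ s < ts (j + 1) :=
    ⟨Nat.find hex, Nat.find_spec hex, fun j hj => Nat.find_min hex hj⟩
  obtain ⟨l, rfl⟩ : ∃ p, l = p + 1 := by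
    refine Nat.exists_eq_succ_of_ne_zero ?_
    rintro rfl
    rw [zero_add] at hl
    linarith
  have hls : ts (l + 1) ≤ s := not_lt.1 (hmin l (by omega))
  have hlen := hdw (l + 1) (by omega)
  have hGs := hG (l + 1) s ⟨hls, hl⟩
  rcases le_total (s + τ / 2) (ts (l + 1 + 1)) with hc | hc
  · exact ⟨s, by linarith, le_rfl, fun r hr => by
      rw [hGs, hG (l + 1) r ⟨by linarith [hr.1], by linarith [hr.2]⟩]⟩
  · exact ⟨s - τ / 2, le_rfl, by linarith, fun r hr => by
      rw [hGs, hG (l + 1) r ⟨by linarith [hr.1], by linarith [hr.2]⟩]⟩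

/-- Triangle inequality along a path, which has fewer than n edges. -/
theorem SimpleGraph.Connected.norm_sub_le {n : ℕ} {H : SimpleGraph (Fin n)} (hH : H.Connected)
    {E : Type*} [NormedAddCommGroup E] (x : Fin n → E) {ε : ℝ} (hε : 0 ≤ ε)
    (hadj : ∀ i j, H.Adj i j → ‖x i - x j‖ ≤ ε) (i j : Fin n) : ‖x i - x j‖ ≤ n * ε := by
  have hwalk : ∀ {i j : Fin n} (p : H.Walk i j), ‖x i - x j‖ ≤ p.length * ε := by
    intro i j p
    induction p with
    | nil => simp
    | @cons a b c hab p ih =>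
      have h1 := norm_sub_le_norm_sub_add_norm_sub (x a) (x b) (x c)
      have h2 := hadj a b hab
      rw [SimpleGraph.Walk.length_cons]
      push_cast
      linarith
  obtain ⟨p, hp⟩ := (hH.preconnected i j).exists_isPath
  have hlen := hp.length_lt
  rw [Fintype.card_fin] at hlen
  have hlen' : (p.length : ℝ) ≤ n := by exact_mod_cast hlen.le
  exact (hwalk p).trans (mul_le_mul_of_nonneg_right hlen' hε)

end Graph

/-! ### From the individual sets to their intersection. -/

section Intersection

/-- A bounded curve approaching each of finitely many closed sets approaches their intersection. -/
theorem tendsto_infDist_iInter {E : Type*} [NormedAddCommGroup E] [ProperSpace E] {ι : Type*}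
    (X : ι → Set E) (hX : ∀ i, IsClosed (X i)) (hne : (⋂ i, X i).Nonempty) (x : ℝ → E) {t₀ : ℝ}
    {z : E} {R : ℝ} (hb : ∀ t, t₀ ≤ t → x t ∈ Metric.closedBall z R)
    (h : ∀ i, Tendsto (fun t => Metric.infDist (x t) (X i)) atTop (𝓝 0)) :
    Tendsto (fun t => Metric.infDist (x t) (⋂ i, X i)) atTop (𝓝 0) := by
  -- By compactness every sequence of times has a subsequence along which x converges; the limit
  -- lies in every X i.
  refine Filter.tendsto_of_subseq_tendsto fun u hu => ?_
  obtain ⟨N, hN⟩ := (hu.eventually_ge_atTop t₀).exists_forall_of_atTop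
  obtain ⟨y, _, φ, hφ, hlim⟩ := (isCompact_closedBall z R).tendsto_subseq
    (x := fun p : ℕ => x (u (p + N))) fun p => hb _ (hN _ (by omega))
  refine ⟨fun p => φ p + N, ?_⟩
  have hmem : ∀ i, y ∈ X i := by
    intro i
    have hnei : (X i).Nonempty := hne.mono (iInter_subset _ i)
    rw [(hX i).mem_iff_infDist_zero hnei]
    have hsub : Tendsto (fun p => u (φ p + N)) atTop atTop :=
      hu.comp ((tendsto_add_atTop_nat N).comp hφ.tendsto_atTop)
    exact tendsto_nhds_unique
      (((Metric.continuous_infDist_pt (X i)).tendsto y).comp hlim) ((h i).comp hsub)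
  have := ((Metric.continuous_infDist_pt (⋂ i, X i)).tendsto y).comp hlim
  rwa [Metric.infDist_zero_of_mem (mem_iInter.2 hmem)] at this

end Intersection

/-! ### Reduction to double integrators. -/

section Reduction

variable {n m : ℕ}

open Classical in
/-- The weight `a i j` if `i` and `j` are neighbours in `G`, and zero otherwise. -/
noncomputable def edgeWeight (G : SimpleGraph (Fin n)) (a : Fin n → Fin n → ℝ) (i j : Fin n) : ℝ :=
  if G.Adj i j then a i j else 0

theorem neighborCoupling_eq_sum_edgeWeight (G : SimpleGraph (Fin n)) (a : Fin n → Fin n → ℝ)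
    (q : Fin n → EuclideanSpace ℝ (Fin m)) (i : Fin n) :
    neighborCoupling G a q i = ∑ j, edgeWeight G a i j • (q i - q j) := by
  simp only [neighborCoupling, edgeWeight, Finset.sum_filter, ite_smul, zero_smul]

theorem matApply_injective_of_posDef {A : Matrix (Fin m) (Fin m) ℝ} (hA : A.PosDef) :
    Function.Injective (matApply A) := by
  intro x y hxy
  have hu : IsUnit (Matrix.toEuclideanCLM (n := Fin m) (𝕜 := ℝ) A) := hA.isUnit.map _
  obtain ⟨u, hu⟩ := hu
  have h : (u : EuclideanSpace ℝ (Fin m) →L[ℝ] EuclideanSpace ℝ (Fin m)) x = u.val y := by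
    rw [hu]; exact hxy
  have h2 := congrArg (u⁻¹).val h
  rw [← mul_apply_eq_comp, ← mul_apply_eq_comp, u.inv_mul] at h2
  simpa using h2

/-- In closed loop the agents are damped double integrators. -/
theorem IsClosedLoopSolution.hasDerivWithinAt_vel {k : ℝ}
    {M : Fin n → EuclideanSpace ℝ (Fin m) → Matrix (Fin m) (Fin m) ℝ}
    {C : Fin n → EuclideanSpace ℝ (Fin m) → EuclideanSpace ℝ (Fin m) →
      Matrix (Fin m) (Fin m) ℝ}
    {X : Fin n → Set (EuclideanSpace ℝ (Fin m))}
    {G : ℝ → SimpleGraph (Fin n)} {a : Fin n → Fin n → ℝ → ℝ} {t₀ : ℝ}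
    {q v : Fin n → ℝ → EuclideanSpace ℝ (Fin m)} (hsol : IsClosedLoopSolution k M C X G a t₀ q v)
    (hM : ∀ i x, (M i x).PosDef) (i : Fin n) (t : ℝ) (ht : t₀ ≤ t) :
    HasDerivWithinAt (v i)
      (-(k • v i t) - (q i t - convexProj (X i) (q i t))
        - ∑ j, edgeWeight (G t) (fun i j => a i j t) i j • (q i t - q j t)) (Ici t) t := by
  obtain ⟨acc, hacc, heq⟩ := hsol.dynamics i t ht
  convert hacc using 1
  refine matApply_injective_of_posDef (hM i (q i t)) ?_
  rw [controlForce, neighborCoupling_eq_sum_edgeWeight] at heq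
  simp only [matApply] at heq ⊢
  rw [map_sub, map_sub, map_neg, map_smul]
  rw [← eq_sub_iff_add_eq] at heq
  rw [heq]
  abel

end Reduction

/-! ### The Lyapunov function and the bounds it gives. -/

/-- A Lyapunov function of the closed loop, for a common point `z` of the target sets. -/
noncomputable def lyapunov {n : ℕ} {E : Type*} [NormedAddCommGroup E] [InnerProductSpace ℝ E] (k : ℝ) (z : E)
    (q v : Fin n → ℝ → E) (t : ℝ) : ℝ :=
  ∑ i, (‖k • (q i t - z) + v i t‖ ^ 2 + ‖v i t‖ ^ 2)

section Lyapunov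

variable {n : ℕ} {E : Type*} [NormedAddCommGroup E] [InnerProductSpace ℝ E]
  {k t₀ : ℝ} {z : E} {q v : Fin n → ℝ → E}

theorem lyapunov_nonneg (k : ℝ) (z : E) (q v : Fin n → ℝ → E) (t : ℝ) :
    0 ≤ lyapunov k z q v t :=
  Finset.sum_nonneg fun i _ => by positivity

theorem continuousOn_lyapunov (hq : ∀ i, ContinuousOn (q i) (Ici t₀))
    (hv : ∀ i, ContinuousOn (v i) (Ici t₀)) : ContinuousOn (lyapunov k z q v) (Ici t₀) := by
  refine continuousOn_finsetSum _ fun i _ => ?_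
  have h1 := hq i
  have h2 := hv i
  fun_prop

theorem hasDerivWithinAt_lyapunov {t : ℝ} {acc : Fin n → E} {s : Set ℝ}
    (hq : ∀ i, HasDerivWithinAt (q i) (v i t) s t)
    (hv : ∀ i, HasDerivWithinAt (v i) (acc i) s t) :
    HasDerivWithinAt (lyapunov k z q v)
      (∑ i, (2 * inner ℝ (k • (q i t - z) + v i t) (k • v i t + acc i)
        + 2 * inner ℝ (v i t) (acc i))) s t := by
  refine HasDerivWithinAt.fun_sum fun i _ => ?_
  exact ((((hq i).sub_const z).const_smul k).add (hv i)).norm_sq.add (hv i).norm_sq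

theorem sq_norm_le_lyapunov (i : Fin n) (t : ℝ) :
    ‖k • (q i t - z) + v i t‖ ^ 2 + ‖v i t‖ ^ 2 ≤ lyapunov k z q v t :=
  Finset.single_le_sum (f := fun i => ‖k • (q i t - z) + v i t‖ ^ 2 + ‖v i t‖ ^ 2)
    (fun i _ => by positivity) (Finset.mem_univ i)

theorem norm_vel_le_sqrt_lyapunov {t B : ℝ} (h : lyapunov k z q v t ≤ B) (i : Fin n) :
    ‖v i t‖ ≤ √B := by
  refine Real.le_sqrt_of_sq_le ?_
  have := sq_norm_le_lyapunov (k := k) (z := z) (q := q) (v := v) i t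
  nlinarith [sq_nonneg ‖k • (q i t - z) + v i t‖]

theorem norm_pos_sub_le_sqrt_lyapunov (hk : 2 ≤ k) {t B : ℝ} (h : lyapunov k z q v t ≤ B)
    (i : Fin n) : ‖q i t - z‖ ≤ √B := by
  have h1 := norm_vel_le_sqrt_lyapunov h i
  have h2 : ‖k • (q i t - z) + v i t‖ ≤ √B := by
    refine Real.le_sqrt_of_sq_le ?_
    have := sq_norm_le_lyapunov (k := k) (z := z) (q := q) (v := v) i t
    nlinarith [sq_nonneg ‖v i t‖]
  -- Both summands are at most √B, and 2 ≤ k absorbs the factor 2.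
  have h3 : ‖k • (q i t - z)‖ ≤ ‖k • (q i t - z) + v i t‖ + ‖v i t‖ := by
    simpa using norm_sub_le (k • (q i t - z) + v i t) (v i t)
  rw [norm_smul, Real.norm_of_nonneg (by linarith)] at h3
  nlinarith [norm_nonneg (q i t - z)]

end Lyapunov

/-! ### Proof of set aggregation. -/

theorem theorem2 (n : ℕ) (aUp : ℝ) (haUp : 0 < aUp) :
    ∃ k₀ : ℝ, 0 < k₀ ∧ ∀ k : ℝ, k₀ ≤ k →
      ∀ (m : ℕ)
        (M : Fin n → EuclideanSpace ℝ (Fin m) → Matrix (Fin m) (Fin m) ℝ)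
        (C : Fin n → EuclideanSpace ℝ (Fin m) → EuclideanSpace ℝ (Fin m) →
          Matrix (Fin m) (Fin m) ℝ)
        (X : Fin n → Set (EuclideanSpace ℝ (Fin m)))
        (t₀ : ℝ) (G : ℝ → SimpleGraph (Fin n)) (a : Fin n → Fin n → ℝ → ℝ) (aLow : ℝ),
        (∀ i, IsLagrangian (M i) (C i)) →
        (∀ i, IsClosed (X i)) → (∀ i, Convex ℝ (X i)) →
        (⋂ i, X i).Nonempty → Bornology.IsBounded (⋂ i, X i) →
        (∀ i j, ContinuousOn (a i j) (Set.Ici t₀)) →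
        (∀ i j t, t₀ ≤ t → a i j t = a j i t) →
        0 < aLow → (∀ i j t, t₀ ≤ t → aLow ≤ a i j t ∧ a i j t ≤ aUp) →
        HasDwellTime G t₀ → UniformlyJointlyConnected G t₀ →
        ∀ q v : Fin n → ℝ → EuclideanSpace ℝ (Fin m),
          IsClosedLoopSolution k M C X G a t₀ q v → AchievesSetAggregation X q v := by
  refine ⟨4 + n * aUp, by positivity, ?_⟩
  intro k hk m M C X t₀ G a aLow hL hXc hXconv hne _ _ hsymm haLow hab hdwell hconn q v hsol
  obtain ⟨z, hz⟩ := hne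
  have hzX : ∀ i, z ∈ X i := mem_iInter.1 hz
  have hnA : 0 ≤ n * aUp := by positivity
  have hM : ∀ i x, (M i x).PosDef := fun i => (hL i).posDef
  have hqc : ∀ i, ContinuousOn (q i) (Ici t₀) := fun i t ht =>
    (hsol.hasDeriv_pos i t ht).continuousWithinAt
  have hqd : ∀ i t, t₀ ≤ t → HasDerivWithinAt (q i) (v i t) (Ici t) t := fun i t ht =>
    (hsol.hasDeriv_pos i t ht).mono (Ici_subset_Ici.2 ht)
  have hvd := hsol.hasDerivWithinAt_vel hM
  set b : ℝ → Fin n → Fin n → ℝ := fun t => edgeWeight (G t) fun i j => a i j t with hb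
  have hb_symm : ∀ t, t₀ ≤ t → ∀ i j, b t i j = b t j i := fun t ht i j => by
    simp only [hb, edgeWeight, hsymm i j t ht]
    split_ifs with h h' h'
    · rfl
    · exact absurd h.symm h'
    · exact absurd h'.symm h
    · rfl
  have hb0 : ∀ t, t₀ ≤ t → ∀ i j, 0 ≤ b t i j := fun t ht i j => by
    simp only [hb, edgeWeight]
    split_ifs
    · exact haLow.le.trans (hab i j t ht).1
    · exact le_rfl
  have hbA : ∀ t, t₀ ≤ t → ∀ i j, b t i j ≤ aUp := fun t ht i j => by
    simp only [hb, edgeWeight]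
    split_ifs
    · exact (hab i j t ht).2
    · exact haUp.le
  set g : Fin n → ℝ → EuclideanSpace ℝ (Fin m) := fun i t => q i t - convexProj (X i) (q i t)
    with hg
  have hg_norm : ∀ i t, ‖g i t‖ = Metric.infDist (q i t) (X i) := fun i t =>
    (convexProj_spec (hXc i) ⟨z, hzX i⟩ (q i t)).2
  set V := lyapunov k z q v with hV
  set W : ℝ → ℝ := fun t => ∑ i, ‖g i t‖ ^ 2 + ∑ i, ∑ j, b t i j * ‖q i t - q j t‖ ^ 2
    + ∑ i, ‖v i t‖ ^ 2 with hW
  have hVc : ContinuousOn V (Ici t₀) := continuousOn_lyapunov hqc hsol.continuousOn_vel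
  have hVd : ∀ t, t₀ ≤ t → ∃ d, HasDerivWithinAt V d (Ici t) t ∧ d ≤ -W t := fun t ht =>
    ⟨_, hasDerivWithinAt_lyapunov (fun i => hqd i t ht) (fun i => hvd i t ht),
      lyapunov_rate_le (b t) (hb_symm t ht) (hb0 t ht) (hbA t ht) haUp.le hk
        (fun i => q i t) (fun i => v i t) (fun i => g i t) z
        fun i => norm_sub_convexProj_sq_le_inner (hXc i) (hXconv i) (hzX i) (q i t)⟩
  have hg0 : ∀ t, 0 ≤ ∑ i, ‖g i t‖ ^ 2 := fun t => Finset.sum_nonneg fun i _ => sq_nonneg _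
  have hv0 : ∀ t, 0 ≤ ∑ i, ‖v i t‖ ^ 2 := fun t => Finset.sum_nonneg fun i _ => sq_nonneg _
  have hD0 : ∀ t, t₀ ≤ t → 0 ≤ ∑ i, ∑ j, b t i j * ‖q i t - q j t‖ ^ 2 := fun t ht =>
    Finset.sum_nonneg fun i _ => Finset.sum_nonneg fun j _ =>
      mul_nonneg (hb0 t ht i j) (sq_nonneg _)
  have hWg : ∀ i t, t₀ ≤ t → ‖g i t‖ ^ 2 ≤ W t := fun i t ht => by
    have := Finset.single_le_sum (f := fun i => ‖g i t‖ ^ 2) (fun i _ => sq_nonneg _)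
      (Finset.mem_univ i)
    have := hv0 t
    have := hD0 t ht
    simp only [hW]
    linarith
  have hWv : ∀ i t, t₀ ≤ t → ‖v i t‖ ^ 2 ≤ W t := fun i t ht => by
    have := Finset.single_le_sum (f := fun i => ‖v i t‖ ^ 2) (fun i _ => sq_nonneg _)
      (Finset.mem_univ i)
    have := hg0 t
    have := hD0 t ht
    simp only [hW]
    linarith
  have hWadj : ∀ i j t, t₀ ≤ t → (G t).Adj i j → aLow * ‖q i t - q j t‖ ^ 2 ≤ W t := by
    intro i j t ht hij
    have h1 := Finset.single_le_sum (f := fun i => ∑ j, b t i j * ‖q i t - q j t‖ ^ 2)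
      (fun i _ => Finset.sum_nonneg fun j _ => mul_nonneg (hb0 t ht i j) (sq_nonneg _))
      (Finset.mem_univ i)
    have h2 := Finset.single_le_sum (f := fun j => b t i j * ‖q i t - q j t‖ ^ 2)
      (fun j _ => mul_nonneg (hb0 t ht i j) (sq_nonneg _)) (Finset.mem_univ j)
    have h3 : aLow * ‖q i t - q j t‖ ^ 2 ≤ b t i j * ‖q i t - q j t‖ ^ 2 := by
      refine mul_le_mul_of_nonneg_right ?_ (sq_nonneg _)
      simp only [hb, edgeWeight, if_pos hij]
      exact (hab i j t ht).1
    have := hg0 t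
    have := hv0 t
    simp only [hW] at h1 h2 ⊢
    linarith
  have hV0 : ∀ t, t₀ ≤ t → 0 ≤ V t := fun t _ => lyapunov_nonneg k z q v t
  have hVanti : AntitoneOn V (Ici t₀) := fun s hs t _ hst => by
    have := dissipation_le_sub hVc hVd (c := 0) hs hst fun r hr => by
      have hr0 : t₀ ≤ r := le_trans hs hr.1
      have := hg0 r
      have := hv0 r
      have := hD0 r hr0
      simp only [hW]
      linarith
    linarith
  have hVle : ∀ t, t₀ ≤ t → V t ≤ V t₀ := fun t ht => hVanti self_mem_Ici ht ht
  set R := √(V t₀) with hR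
  have hR0 : 0 ≤ R := Real.sqrt_nonneg _
  have hvR : ∀ i t, t₀ ≤ t → ‖v i t‖ ≤ R := fun i t ht => norm_vel_le_sqrt_lyapunov (hVle t ht) i
  have hqR : ∀ i t, t₀ ≤ t → ‖q i t - z‖ ≤ R := fun i t ht =>
    norm_pos_sub_le_sqrt_lyapunov (by linarith) (hVle t ht) i
  -- The speed bound c stays free: it is R for the Barbalat argument and small in the edge estimate.
  have hqlip : ∀ (c : ℝ) (i : Fin n) (s t : ℝ), t₀ ≤ s → s ≤ t →
      (∀ r, s ≤ r → ‖v i r‖ ≤ c) → ‖q i t - q i s‖ ≤ c * (t - s) := fun c i s t hs hst hc =>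
    norm_image_sub_le_of_norm_deriv_right_le_segment
      ((hqc i).mono fun r hr => hs.trans hr.1) (fun r hr => hqd i r (hs.trans hr.1))
      (fun r hr => hc r hr.1) t (right_mem_Icc.2 hst)
  -- Acceleration bound: damping, distance to the target set, and n coupling terms.
  set K := k * R + R + n * (aUp * (2 * R)) with hK
  have hK0 : 0 ≤ K := by
    have : 0 ≤ k := by linarith
    positivity
  have hvlip : ∀ (i : Fin n) (s t : ℝ), t₀ ≤ s → s ≤ t → ‖v i t - v i s‖ ≤ K * (t - s) := by
    intro i s t hs hst
    refine norm_image_sub_le_of_norm_deriv_right_le_segment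
      ((hsol.continuousOn_vel i).mono fun r hr => hs.trans hr.1)
      (fun r hr => hvd i r (hs.trans hr.1)) (fun r hr => ?_) t (right_mem_Icc.2 hst)
    have hr0 : t₀ ≤ r := hs.trans hr.1
    refine (norm_sub_le _ _).trans (add_le_add ((norm_sub_le _ _).trans (add_le_add ?_ ?_)) ?_)
    · rw [norm_neg, norm_smul, Real.norm_of_nonneg (by linarith)]
      exact mul_le_mul_of_nonneg_left (hvR i r hr0) (by linarith)
    · have h1 := Metric.infDist_le_dist_of_mem (x := q i r) (hzX i)
      rw [dist_eq_norm] at h1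
      exact (hg_norm i r).trans_le (h1.trans (hqR i r hr0))
    · refine (norm_sum_le _ _).trans ?_
      have : ∑ _j : Fin n, aUp * (2 * R) = n * (aUp * (2 * R)) := by simp
      rw [← this]
      refine Finset.sum_le_sum fun j _ => ?_
      rw [norm_smul, Real.norm_of_nonneg (hb0 r hr0 i j)]
      refine mul_le_mul (hbA r hr0 i j) ?_ (norm_nonneg _) haUp.le
      have h2 := norm_sub_le_norm_sub_add_norm_sub (q i r) z (q j r)
      rw [norm_sub_rev z] at h2
      linarith [hqR i r hr0, hqR j r hr0]
  have hv_lim : ∀ i, Tendsto (v i) atTop (𝓝 0) := fun i => by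
    refine tendsto_zero_iff_norm_tendsto_zero.2 ?_
    refine tendsto_zero_of_dissipation hVc hVd hVanti hV0 (fun _ _ => norm_nonneg _) hK0
      (fun s t hs hst => ?_) (hWv i)
    have h1 := norm_le_norm_add_norm_sub (v i t) (v i s)
    linarith [hvlip i s t hs hst]
  have hg_lim : ∀ i, Tendsto (fun t => Metric.infDist (q i t) (X i)) atTop (𝓝 0) := fun i => by
    refine tendsto_zero_of_dissipation hVc hVd hVanti hV0 (fun _ _ => Metric.infDist_nonneg) hR0
      (fun s t hs hst => ?_) (fun t ht => by rw [← hg_norm]; exact hWg i t ht)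
    refine Metric.infDist_le_infDist_add_dist.trans (add_le_add le_rfl ?_)
    rw [dist_eq_norm, norm_sub_rev]
    exact hqlip R i s t hs hst fun r hr => hvR i r (hs.trans hr)
  obtain ⟨δ, t₁, hδ, ht₁, hwin⟩ := hdwell.exists_constant_window
  obtain ⟨T, hT, hconn⟩ := hconn
  have hedge : ∀ ε : ℝ, 0 < ε → ∀ᶠ t in atTop, ∀ i j, (⨆ s ∈ Ico t (t + T), G s).Adj i j →
      ‖q i t - q j t‖ ≤ ε := by
    intro ε hε
    -- Edges seen in [t, t + T) have windows inside [t - δ, t + T + δ], of length S. At speed at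
    -- most c, no agent moves more than ε / 4 from its position at t.
    set S := T + 2 * δ with hS
    have hS0 : 0 < S := by positivity
    set c := ε / (4 * S) with hc
    have hc0 : 0 < c := by positivity
    have hcS : c * S = ε / 4 := by rw [hc]; field_simp
    obtain ⟨t₂, ht₂, hdec⟩ := eventually_decrement_lt hVanti hV0
      (show 0 < aLow * (ε / 2) ^ 2 * δ by positivity)
    have hvsmall : ∀ᶠ t in atTop, ∀ i, ‖v i t‖ ≤ c := Filter.eventually_all.2 fun i =>
      ((tendsto_zero_iff_norm_tendsto_zero.1 (hv_lim i)).eventually_lt_const hc0).mono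
        fun t ht => ht.le
    obtain ⟨t₃, ht₃⟩ := eventually_atTop.1 hvsmall
    filter_upwards [eventually_ge_atTop (t₁ + δ), eventually_ge_atTop (t₂ + δ),
      eventually_ge_atTop (t₃ + δ)] with t h1 h2 h3 i j hij
    simp only [SimpleGraph.iSup_adj] at hij
    obtain ⟨s, hs, hij⟩ := hij
    obtain ⟨u, hu1, hu2, hu⟩ := hwin s (by linarith [hs.1])
    by_contra! hcon
    have hut : t - δ ≤ u := by linarith [hs.1]
    have hu0 : t₀ ≤ u := by linarith
    have hvar : ∀ r, t - δ ≤ r → r ≤ t + T + δ → ∀ l, ‖q l t - q l r‖ ≤ ε / 4 := by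
      intro r hr1 hr2 l
      rw [← hcS]
      rcases le_total r t with hrt | hrt
      · refine (hqlip c l r t (by linarith) hrt fun w hw => ht₃ w (by linarith) l).trans ?_
        exact mul_le_mul_of_nonneg_left (by linarith) hc0.le
      · rw [norm_sub_rev]
        refine (hqlip c l t r (by linarith) hrt fun w hw => ht₃ w (by linarith) l).trans ?_
        exact mul_le_mul_of_nonneg_left (by linarith) hc0.le
    -- A gap above ε at time t remains at least ε / 2 on the whole window where the edge is active.
    have hdis := dissipation_le_sub hVc hVd (s := u) (t := u + δ) (c := aLow * (ε / 2) ^ 2) hu0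
      (by linarith) fun r hr => by
        have hr0 : t₀ ≤ r := hu0.trans hr.1
        refine le_trans ?_ (hWadj i j r hr0 (by rw [hu r hr]; exact hij))
        refine mul_le_mul_of_nonneg_left (pow_le_pow_left₀ (by positivity) ?_ 2) haLow.le
        have hrt : t - δ ≤ r := hut.trans hr.1
        have hrT : r ≤ t + T + δ := by linarith [hr.2, hs.2]
        have e : q i t - q j t = (q i t - q i r) + (q i r - q j r) - (q j t - q j r) := by abel
        have h4 : ‖q i t - q j t‖ ≤ ‖q i t - q i r‖ + ‖q i r - q j r‖ + ‖q j t - q j r‖ := by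
          rw [e]
          exact (norm_sub_le _ _).trans (add_le_add (norm_add_le _ _) le_rfl)
        linarith [hvar r hrt hrT i, hvar r hrt hrT j]
    rw [add_sub_cancel_left] at hdis
    linarith [hdec u (u + δ) (by linarith) (by linarith)]
  have hcons : ∀ i j, Tendsto (fun t => q i t - q j t) atTop (𝓝 0) := by
    intro i j
    rw [Metric.tendsto_nhds]
    intro ε hε
    -- Dividing by n + 1 makes the final inequality strict.
    have hn : (0 : ℝ) < n + 1 := by positivity
    filter_upwards [hedge (ε / (n + 1)) (by positivity), eventually_ge_atTop t₀] with t ht ht0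
    rw [dist_zero_right]
    refine ((hconn t ht0).norm_sub_le (fun i => q i t) (by positivity) ht i j).trans_lt ?_
    rw [mul_div_assoc', div_lt_iff₀ hn]
    linarith
  refine ⟨fun i => ?_, hcons, hv_lim⟩
  refine tendsto_infDist_iInter X hXc ⟨z, hz⟩ (q i) (t₀ := t₀) (z := z) (R := R)
    (fun t ht => by rw [mem_closedBall_iff_norm]; exact hqR i t ht) fun j => ?_
  -- Agent i inherits proximity to X j from agent j through consensus.
  have hsum : Tendsto (fun t => Metric.infDist (q j t) (X j) + ‖q i t - q j t‖) atTop (𝓝 0) := by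
    simpa using (hg_lim j).add (tendsto_zero_iff_norm_tendsto_zero.1 (hcons i j))
  refine squeeze_zero (fun _ => Metric.infDist_nonneg) (fun t => ?_) hsum
  rw [← dist_eq_norm]
  exact Metric.infDist_le_infDist_add_dist
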